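/- For an integer $k \ge 1$ let $X(k)$ be the simple graph with $6k+1$ vertices: a hub $h$ and, for each $i \in \mathbb{Z}/k$, six vertices $m_i, l_i, r_i, a_i, b_i, c_i$. Its edges are: for every $i$, the nine edges joining each of $m_i, l_i, r_i$ to each of $a_i, b_i, c_i$ (a copy of $K_{3,3}$); the edges $h m_i$ for every $i$; and the edges $r_i l_{i+1}$ for every $i$ (indices modulo $k$; for $k=1$ this is the edge $r_0 l_0$). In other words, $X(k)$ is obtained from the $k$-spoke wheel by replacing each rim vertex with a copy of $K_{3,3}$, the three edges at the rim vertex being attached to the three vertices of one side. For a finite graph $G$ let $P_G(q)$ be its chromatic polynomial, i.e. the polynomial whose value at every non-negative integer $q$ is the number of proper $q$-colourings of $G$. A graph is $3$-connected if it has more than $3$ vertices and remains connected whenever fewer than $3$ vertices are deleted. A complete cutset of a graph is a set of pairwise adjacent vertices whose deletion disconnects it. 1. For every $k \ge 1$, $(q-2)^k$ divides $P_{X(k)}(q)$ in $\mathbb{Z}[q]$. 2. For every $k \ge 3$, the graph $X(k)$ is $3$-connected and has no complete cutset. 3. Consequently, for every natural number $k$ there is a finite $3$-connected graph $G$ without a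 complete cutset such that $(q-2)^k \mid P_G(q)$; that is, $q=2$ is a root of $P_G$ of multiplicity at least $k$. -/

import Mathlib

namespace SimpleGraph

/-- Inclusion–exclusion over sets of edges: the number of proper `q`-colourings of a finite graph
is given by a polynomial in `q`, and only one integer polynomial does so. -/
theorem existsUnique_chromaticPolynomial {V : Type*} [Finite V] (G : SimpleGraph V) :
    ∃! P : Polynomial ℤ, ∀ q : ℕ, P.eval (q : ℤ) = (Nat.card (G.Coloring (Fin q)) : ℤ) := by
  classical
  have : Fintype V := Fintype.ofFinite V
  refine existsUnique_of_exists_of_unique ?_ ?_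
  · refine ⟨∑ A ∈ G.edgeFinset.powerset, (-1) ^ A.card *
      Polynomial.X ^ (Nat.card (fromEdgeSet (A : Set (Sym2 V))).ConnectedComponent), fun q => ?_⟩
    have hcomp : ∀ A ∈ G.edgeFinset.powerset,
        q ^ (Nat.card (fromEdgeSet (A : Set (Sym2 V))).ConnectedComponent) =
          (Finset.univ.filter
            (fun f : V → Fin q => ∀ e ∈ A, (e.map f).IsDiag)).card := by
      intro A _
      have hlift : ∀ f : V → Fin q, (∀ e ∈ A, (e.map f).IsDiag) →
          ∀ (v w : V) (p : (fromEdgeSet (A : Set (Sym2 V))).Walk v w), f v = f w := by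
        intro f hf v w p
        induction p with
        | nil => rfl
        | cons h _ ih =>
          rw [fromEdgeSet_adj] at h
          have := hf _ (Finset.mem_coe.1 h.1)
          simp only [Sym2.map_mk, Sym2.mk_isDiag_iff] at this
          exact this.trans ih
      have e : {f : V → Fin q // ∀ e ∈ A, (e.map f).IsDiag} ≃
          ((fromEdgeSet (A : Set (Sym2 V))).ConnectedComponent → Fin q) :=
        { toFun := fun f c => c.lift f.1 (fun v w p _ => hlift f.1 f.2 v w p)
          invFun := fun g => ⟨fun v => g (connectedComponentMk _ v), by
            intro e he
            induction e with
            | h v w =>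
              simp only [Sym2.map_mk, Sym2.mk_isDiag_iff]
              by_cases hvw : v = w
              · rw [hvw]
              · congr 1
                refine ConnectedComponent.sound (Adj.reachable ?_)
                rw [fromEdgeSet_adj]
                exact ⟨Finset.mem_coe.2 he, hvw⟩⟩
          left_inv := fun f => rfl
          right_inv := fun g => by
            funext c
            induction c using ConnectedComponent.ind
            rfl }
      have h1 := Nat.card_congr e
      rw [Nat.card_fun, Nat.card_fin, Nat.card_eq_fintype_card, Fintype.card_subtype] at h1
      exact h1.symm
    have hcol : Nat.card (G.Coloring (Fin q)) = (Finset.univ.filter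
        (fun f : V → Fin q => ∀ v w, G.Adj v w → f v ≠ f w)).card := by
      have e : G.Coloring (Fin q) ≃ {f : V → Fin q // ∀ v w, G.Adj v w → f v ≠ f w} :=
        { toFun := fun C => ⟨C, fun v w h => C.valid h⟩
          invFun := fun f => Coloring.mk f.1 (fun {v w} h => f.2 v w h)
          left_inv := fun C => rfl
          right_inv := fun f => rfl }
      rw [Nat.card_congr e, Nat.card_eq_fintype_card, Fintype.card_subtype]
    rw [hcol, Polynomial.eval_finsetSum, Finset.card_filter]
    push_cast
    calc _ = ∑ A ∈ G.edgeFinset.powerset, ∑ f : V → Fin q,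
          if ∀ e ∈ A, (e.map f).IsDiag then (-1 : ℤ) ^ A.card else 0 := by
          refine Finset.sum_congr rfl fun A hA => ?_
          have := hcomp A hA
          simp only [Polynomial.eval_mul, Polynomial.eval_pow, Polynomial.eval_neg,
            Polynomial.eval_one, Polynomial.eval_X]
          rw [← Nat.cast_pow, this, ← Finset.sum_filter, Finset.sum_const, nsmul_eq_mul, mul_comm]
      _ = ∑ f : V → Fin q, ∑ A ∈ G.edgeFinset.powerset,
          if ∀ e ∈ A, (e.map f).IsDiag then (-1 : ℤ) ^ A.card else 0 := Finset.sum_comm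
      _ = _ := by
          refine Finset.sum_congr rfl fun f _ => ?_
          have hp : G.edgeFinset.powerset.filter (fun A => ∀ e ∈ A, (e.map f).IsDiag) =
              (G.edgeFinset.filter (fun e => (e.map f).IsDiag)).powerset := by
            ext A
            simp only [Finset.mem_filter, Finset.mem_powerset, Finset.subset_iff]
            constructor
            · exact fun h e he => ⟨h.1 he, h.2 e he⟩
            · exact fun h => ⟨fun e he => (h he).1, fun e he => (h he).2⟩
          rw [← Finset.sum_filter, hp, Finset.sum_powerset_neg_one_pow_card]
          refine if_congr ?_ rfl rfl
          rw [Finset.filter_eq_empty_iff]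
          constructor
          · intro h v w hvw heq
            exact h (x := s(v, w)) (by simpa using hvw) (by simpa using heq)
          · intro h e he
            induction e with
            | h v w =>
              simp only [Sym2.map_mk, Sym2.mk_isDiag_iff]
              exact h v w (by simpa using he)
  · intro P Q hP hQ
    refine Polynomial.eq_of_infinite_eval_eq P Q ?_
    refine (Set.infinite_range_of_injective (Nat.cast_injective (R := ℤ))).mono ?_
    rintro _ ⟨q, rfl⟩
    exact (hP q).trans (hQ q).symm

/-- The chromatic polynomial of a finite graph: the polynomial whose value at every non-negative
integer `q` is the number of proper `q`-colourings. -/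
noncomputable def chromaticPolynomial {V : Type*} [Finite V] (G : SimpleGraph V) :
    Polynomial ℤ :=
  (existsUnique_chromaticPolynomial G).choose

/-- The defining property of the chromatic polynomial. -/
theorem eval_chromaticPolynomial {V : Type*} [Finite V] (G : SimpleGraph V) (q : ℕ) :
    G.chromaticPolynomial.eval (q : ℤ) = (Nat.card (G.Coloring (Fin q)) : ℤ) :=
  (existsUnique_chromaticPolynomial G).choose_spec.1 q

/-- `G` is `k`-connected (vertex connectivity): it has more than `k` vertices, and deleting fewer
than `k` vertices always leaves a connected graph. -/
def IsVertexConnected {V : Type*} (k : ℕ) (G : SimpleGraph V) : Prop :=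
  (k : ℕ∞) < ENat.card V ∧ ∀ S : Finset V, S.card < k → (G.induce (S : Set V)ᶜ).Connected

/-- A complete cutset: a set of pairwise adjacent vertices whose deletion leaves a disconnected
graph, i.e. one containing two vertices not joined by a path. -/
def IsCompleteCutset {V : Type*} (G : SimpleGraph V) (S : Set V) : Prop :=
  G.IsClique S ∧ ¬ (G.induce Sᶜ).Preconnected

/-- The vertices of `X(k)`: the hub `none` of the `k`-spoke wheel, and six vertices `some (i, a)`
for each rim vertex `i`.  Replacing a rim vertex by a triangle, subdividing the edges of the
triangle and joining each subdividing vertex to the opposite corner gives a copy of `K_{3,3}` in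
which one side consists of the corners `Sum.inl 0`, `Sum.inl 1`, `Sum.inl 2` and the other side
of the subdividing vertices `Sum.inr 0`, `Sum.inr 1`, `Sum.inr 2`. -/
abbrev XVertex (k : ℕ) : Type := Option (Fin k × (Fin 3 ⊕ Fin 3))

/-- The edges of `X(k)`, each listed in at least one of its two orientations.  The spoke at the
rim vertex `i` ends at the corner `Sum.inl 0` of the `i`-th copy of `K_{3,3}`, and the rim edge
from `i` to its cyclic successor joins the corner `Sum.inl 2` of the `i`-th copy to the corner
`Sum.inl 1` of the next one. -/
def XRel (k : ℕ) : XVertex k → XVertex k → Prop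
  | none, some (_, a) => a = Sum.inl 0
  | some (i, a), some (j, b) =>
      (i = j ∧ (completeBipartiteGraph (Fin 3) (Fin 3)).Adj a b) ∨
      ((j : ℕ) = ((i : ℕ) + 1) % k ∧ a = Sum.inl 2 ∧ b = Sum.inl 1)
  | _, none => False

/-- The graph `X(k)`, obtained from the `k`-spoke wheel by replacing each rim vertex by a copy of
`K_{3,3}`.  For `k = 1` the single copy has its own corners `Sum.inl 2` and `Sum.inl 1` joined,
and for `k = 2` the two copies are joined by two rim edges. -/
def XGraph (k : ℕ) : SimpleGraph (XVertex k) := fromRel (XRel k)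

end SimpleGraph

open Polynomial in
/-- A bound on the order of vanishing at `t = q - 2` of the parameters of a `hubMatrix` on
`n + 1 = q` colours, compatible with multiplication of such matrices. -/
def VanishesToOrder (k : ℕ) (a b c d l : ℤ[X]) : Prop :=
  (X - C 2) ^ k ∣ a ∧ (X - C 2) ^ (k + 1) ∣ b ∧ (X - C 2) ^ k ∣ (X - C 2) * c ∧
    (X - C 2) ^ k ∣ (X - 1) * d + l ∧ (X - C 2) ^ k ∣ l

open Polynomial in
theorem VanishesToOrder.mul {i j : ℕ} {a b c d l a' b' c' d' l' : ℤ[X]}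
    (h : VanishesToOrder i a b c d l) (h' : VanishesToOrder j a' b' c' d' l') :
    VanishesToOrder (i + j) (a * a' + (X - 1) * (b * c')) (a * b' + b * ((X - 1) * d' + l'))
      (c * a' + ((X - 1) * d + l) * c') (c * b' + (X - 1) * (d * d') + d * l' + l * d')
      (l * l') := by
  obtain ⟨⟨a0, ha⟩, ⟨b0, hb⟩, ⟨c0, hc⟩, ⟨d0, hd⟩, ⟨l0, hl⟩⟩ := h
  obtain ⟨⟨a1, ha'⟩, ⟨b1, hb'⟩, ⟨c1, hc'⟩, ⟨d1, hd'⟩, ⟨l1, hl'⟩⟩ := h'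
  unfold VanishesToOrder
  generalize (X - C 2 : ℤ[X]) = t at ha hb hc hd hl ha' hb' hc' hd' hl' ⊢
  generalize (X - 1 : ℤ[X]) = n at hd hd' ⊢
  refine ⟨⟨a0 * a1 + n * (b0 * c1), ?_⟩, ⟨a0 * b1 + b0 * d1, ?_⟩, ⟨c0 * a1 + d0 * c1, ?_⟩,
    ⟨n * (c0 * b1) + d0 * d1, ?_⟩, ⟨l0 * l1, ?_⟩⟩
  · linear_combination a' * ha + t ^ i * a0 * ha' + n * c' * hb + n * b0 * t ^ i * hc'
  · linear_combination b' * ha + t ^ i * a0 * hb' + (n * d' + l') * hb + t ^ (i + 1) * b0 * hd'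
  · linear_combination a' * hc + t ^ i * c0 * ha' + t * c' * hd + t ^ i * d0 * hc'
  · linear_combination n * c * hb' + n * b1 * t ^ j * hc + (n * d' + l') * hd + t ^ i * d0 * hd'
  · linear_combination l' * hl + t ^ i * l0 * hl'

section HubMatrix

variable {α : Type*} [DecidableEq α]

/-- The matrices invariant under all permutations of the index set that fix `h`. -/
def hubMatrix (h : α) (a b c d l : ℤ) : Matrix α α ℤ :=
  Matrix.of fun x y =>
    if x = h then if y = h then a else b
    else if y = h then c else if x = y then d + l else d

theorem one_eq_hubMatrix (h : α) : (1 : Matrix α α ℤ) = hubMatrix h 1 0 0 0 1 := by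
  ext x y
  simp only [Matrix.one_apply, hubMatrix, Matrix.of_apply]
  grind

theorem card_triple_pow (m x r : α) (q : ℤ) :
    (q - ({m, x, r} : Finset α).card) ^ 3 =
      if m = x ∧ x = r then (q - 1) ^ 3 else if m = x ∨ x = r ∨ m = r then (q - 2) ^ 3
      else (q - 3) ^ 3 := by
  by_cases h1 : m = x <;> by_cases h2 : x = r <;> by_cases h3 : m = r <;>
    simp_all [Finset.card_insert_of_notMem]

variable [Fintype α]

theorem sum_eq_of_eq_off (s : Finset α) (f : α → ℤ) (c : ℤ) (hf : ∀ x ∉ s, f x = c) :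
    ∑ x, f x = ∑ x ∈ s, f x + (Fintype.card α - s.card) * c := by
  rw [← Finset.sum_add_sum_compl s f,
    Finset.sum_congr (s₁ := sᶜ) rfl fun x hx => hf x (by simpa using hx),
    Finset.sum_const, Finset.card_compl, nsmul_eq_mul, Nat.cast_sub (Finset.card_le_univ s)]

theorem hubMatrix_mul (h : α) (a b c d l a' b' c' d' l' n : ℤ)
    (hn : (Fintype.card α : ℤ) = n + 1) :
    hubMatrix h a b c d l * hubMatrix h a' b' c' d' l' =
      hubMatrix h (a * a' + n * (b * c')) (a * b' + b * (n * d' + l'))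
        (c * a' + (n * d + l) * c') (c * b' + n * (d * d') + d * l' + l * d') (l * l') := by
  ext x y
  rw [Matrix.mul_apply]
  simp only [hubMatrix, Matrix.of_apply]
  by_cases hx : x = h <;> by_cases hy : y = h
  · rw [sum_eq_of_eq_off {h} _ (b * c') (by grind)]
    simp [hx, hy, hn]
  · rw [sum_eq_of_eq_off {h, y} _ (b * d') (by grind)]
    rw [Finset.sum_pair (Ne.symm hy), Finset.card_pair (Ne.symm hy)]
    simp [hx, hy, hn]; ring
  · rw [sum_eq_of_eq_off {h, x} _ (d * c') (by grind)]
    rw [Finset.sum_pair (Ne.symm hx), Finset.card_pair (Ne.symm hx)]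
    simp [hx, hy, hn]; ring
  · by_cases hxy : x = y
    · subst hxy
      rw [sum_eq_of_eq_off {h, x} _ (d * d') (by grind)]
      rw [Finset.sum_pair (Ne.symm hx), Finset.card_pair (Ne.symm hx)]
      simp [hx, hn]; ring
    · rw [sum_eq_of_eq_off {h, x, y} _ (d * d') (by grind)]
      rw [Finset.sum_insert (by grind), Finset.sum_pair hxy, Finset.card_insert_of_notMem (by grind),
        Finset.card_pair hxy]
      simp [hx, hy, hxy, hn]; ring

theorem trace_hubMatrix (h : α) (a b c d l n : ℤ) (hn : (Fintype.card α : ℤ) = n + 1) :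
    (hubMatrix h a b c d l).trace = a + n * (d + l) := by
  simp only [Matrix.trace, Matrix.diag, hubMatrix, Matrix.of_apply]
  rw [sum_eq_of_eq_off {h} _ (d + l) (by grind)]
  simp [hn]

/-- The transfer matrix: `transfer h x y` counts the colourings of a copy of `K_{3,3}` whose
corner `0` avoids `h`, whose corner `1` has colour `x` and whose corner `2` avoids `y`. -/
def transfer (h : α) : Matrix α α ℤ :=
  Matrix.of fun x y => ∑ r, if r = y then 0 else
    ∑ m, if m = h then 0 else (Fintype.card α - ({m, x, r} : Finset α).card : ℤ) ^ 3

theorem corner_sum_eq_hubMatrix (h : α) (q : ℤ) (hq : (Fintype.card α : ℤ) = q) :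
    (Matrix.of fun x r => ∑ m, if m = h then 0 else
      (q - ({m, x, r} : Finset α).card : ℤ) ^ 3) =
    hubMatrix h ((q - 1) * (q - 2) ^ 3) ((q - 2) ^ 3 + (q - 2) * (q - 3) ^ 3)
      ((q - 2) ^ 3 + (q - 2) * (q - 3) ^ 3) (2 * (q - 2) ^ 3 + (q - 3) ^ 4)
      ((q - 1) ^ 3 + (q - 2) ^ 4 - (2 * (q - 2) ^ 3 + (q - 3) ^ 4)) := by
  ext x y
  simp only [hubMatrix, Matrix.of_apply, card_triple_pow]
  by_cases hx : x = h <;> by_cases hy : y = h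
  · rw [sum_eq_of_eq_off {h} _ ((q - 2) ^ 3) (by grind)]
    simp [hx, hy, hq]
  · rw [sum_eq_of_eq_off {h, y} _ ((q - 3) ^ 3) (by grind)]
    rw [Finset.sum_pair (Ne.symm hy), Finset.card_pair (Ne.symm hy)]
    simp [hx, hy, Ne.symm hy, hq]
  · rw [sum_eq_of_eq_off {h, x} _ ((q - 3) ^ 3) (by grind)]
    rw [Finset.sum_pair (Ne.symm hx), Finset.card_pair (Ne.symm hx)]
    simp [hx, hy, hq]
  · by_cases hxy : x = y
    · subst hxy
      rw [sum_eq_of_eq_off {h, x} _ ((q - 2) ^ 3) (by grind)]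
      rw [Finset.sum_pair (Ne.symm hx), Finset.card_pair (Ne.symm hx)]
      simp [hx, hq]; ring
    · rw [sum_eq_of_eq_off {h, x, y} _ ((q - 3) ^ 3) (by grind)]
      rw [Finset.sum_insert (by grind), Finset.sum_pair hxy,
        Finset.card_insert_of_notMem (by grind), Finset.card_pair hxy]
      simp [hx, hy, hxy, Ne.symm hxy, hq]; ring

theorem transfer_eq (h : α) (q : ℤ) (hq : (Fintype.card α : ℤ) = q) :
    transfer h = hubMatrix h ((q - 1) * (q - 2) ^ 3) ((q - 2) ^ 3 + (q - 2) * (q - 3) ^ 3)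
      ((q - 2) ^ 3 + (q - 2) * (q - 3) ^ 3) (2 * (q - 2) ^ 3 + (q - 3) ^ 4)
      ((q - 1) ^ 3 + (q - 2) ^ 4 - (2 * (q - 2) ^ 3 + (q - 3) ^ 4)) *
      hubMatrix h 0 1 1 1 (-1) := by
  rw [← corner_sum_eq_hubMatrix h q hq]
  ext x y
  rw [Matrix.mul_apply]
  simp only [transfer, Matrix.of_apply, hubMatrix, hq]
  refine Finset.sum_congr rfl fun r _ => ?_
  have : (if r = h then if y = h then (0 : ℤ) else 1
      else if y = h then 1 else if r = y then 1 + -1 else 1) = if r = y then 0 else 1 := by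
    grind
  rw [this]
  split_ifs <;> simp

end HubMatrix

open Polynomial in
theorem exists_transfer_params : ∃ a b c d l : ℤ[X], VanishesToOrder 1 a b c d l ∧
    ∀ (q : ℕ) (h : Fin q), transfer h =
      hubMatrix h (a.eval (q : ℤ)) (b.eval (q : ℤ)) (c.eval (q : ℤ)) (d.eval (q : ℤ))
        (l.eval (q : ℤ)) := by
  let e : ℤ[X] := (X - 2) ^ 3
  let f : ℤ[X] := (X - 2) ^ 3 + (X - 2) * (X - 3) ^ 3
  let g : ℤ[X] := 2 * (X - 2) ^ 3 + (X - 3) ^ 4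
  let u : ℤ[X] := (X - 1) ^ 3 + (X - 2) ^ 4 - g
  have hu : (X - C 2 : ℤ[X]) ∣ u :=
    ⟨3 * (X - 2) ^ 2 - 3 * (X - 2) + 7, by simp [u, g]; ring⟩
  refine ⟨(X - 1) * f, (X - 1) * e + f * ((X - 1) - 1), (X - 1) * g + u,
    f + (X - 1) * g - g + u, -u, ⟨?_, ?_, ?_, ?_, ?_⟩, fun q h => ?_⟩
  · exact ⟨(X - 1) * ((X - 2) ^ 2 + (X - 3) ^ 3), by simp [f]; ring⟩
  · exact ⟨(X - 1) * (X - 2) + ((X - 2) ^ 2 + (X - 3) ^ 3), by simp [e, f]; ring⟩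
  · simp
  · rw [pow_one]
    have hf : (X - C 2 : ℤ[X]) ∣ f := ⟨(X - 2) ^ 2 + (X - 3) ^ 3, by simp [f]; ring⟩
    convert ((hf.mul_left (X - 1)).add (dvd_mul_right (X - C 2) ((X - 1) * g))).add
      (hu.mul_left (X - C 2)) using 1
    simp; ring
  · rw [pow_one]
    exact hu.neg_right
  · rw [transfer_eq h (q : ℤ) (by simp),
      hubMatrix_mul h _ _ _ _ _ _ _ _ _ _ ((q : ℤ) - 1) (by simp)]
    congr 1 <;> simp only [e, f, g, u, eval_add, eval_sub, eval_mul, eval_pow, eval_neg, eval_X,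
      eval_one, eval_ofNat] <;> ring

namespace SimpleGraph

theorem XRel_succ_some_some (n : ℕ) (i j : Fin (n + 1)) (a b : Fin 3 ⊕ Fin 3) :
    XRel (n + 1) (some (i, a)) (some (j, b)) ↔
      (i = j ∧ (completeBipartiteGraph (Fin 3) (Fin 3)).Adj a b) ∨
      (j = i + 1 ∧ a = Sum.inl 2 ∧ b = Sum.inl 1) := by
  have : (j : ℕ) = ((i : ℕ) + 1) % (n + 1) ↔ j = i + 1 := by
    rw [Fin.ext_iff, Fin.val_add, Fin.val_one', Nat.add_mod_mod]
  simp only [XRel, this]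

theorem XGraph_adj_none_some (k : ℕ) (i : Fin k) (a : Fin 3 ⊕ Fin 3) :
    (XGraph k).Adj none (some (i, a)) ↔ a = Sum.inl 0 := by
  simp [XGraph, XRel]

theorem XGraph_adj_some_some (n : ℕ) (i j : Fin (n + 1)) (a b : Fin 3 ⊕ Fin 3) :
    (XGraph (n + 1)).Adj (some (i, a)) (some (j, b)) ↔
      (i = j ∧ (completeBipartiteGraph (Fin 3) (Fin 3)).Adj a b) ∨
      (j = i + 1 ∧ a = Sum.inl 2 ∧ b = Sum.inl 1) ∨
      (i = j + 1 ∧ b = Sum.inl 2 ∧ a = Sum.inl 1) := by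
  simp only [XGraph, fromRel_adj, XRel_succ_some_some, completeBipartiteGraph_adj]
  constructor
  · rintro ⟨_, h⟩
    grind
  · intro h
    refine ⟨?_, by grind⟩
    rintro h'
    simp only [Option.some.injEq, Prod.mk.injEq] at h'
    obtain ⟨rfl, rfl⟩ := h'
    rcases h with h | h | h
    · cases a <;> simp at h
    · grind
    · grind

theorem XGraph_cliqueFree_three (n : ℕ) (hn : 2 ≤ n) (u v w : XVertex (n + 1))
    (huv : (XGraph (n + 1)).Adj u v) (huw : (XGraph (n + 1)).Adj u w)
    (hvw : (XGraph (n + 1)).Adj v w) : False := by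
  have key : ∀ v w, (XGraph (n + 1)).Adj none v → (XGraph (n + 1)).Adj none w →
      ¬ (XGraph (n + 1)).Adj v w := by
    rintro (_ | ⟨i, a⟩) (_ | ⟨j, b⟩) h1 h2 h3
    · exact h1.ne rfl
    · exact h1.ne rfl
    · exact h2.ne rfl
    · rw [XGraph_adj_none_some] at h1 h2
      subst h1 h2
      simp [XGraph_adj_some_some] at h3
  have hself : ∀ i : Fin (n + 1), i ≠ i + 1 := by
    intro i h
    have := congrArg Fin.val (left_eq_add.1 h)
    simp at this
    omega
  rcases u with _ | ⟨i, a⟩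
  · exact key _ _ huv huw hvw
  rcases v with _ | ⟨j, b⟩
  · exact key _ _ huv.symm hvw huw
  rcases w with _ | ⟨l, c⟩
  · exact key _ _ huw.symm hvw.symm huv
  rw [XGraph_adj_some_some] at huv huw hvw
  rcases a with a | a <;> rcases b with b | b <;> rcases c with c | c <;>
    simp at huv huw hvw <;> grind

/-- `u` and `v` survive the deletion of `S` and are joined by a path avoiding `S`. -/
def ReachableOff {V : Type*} (G : SimpleGraph V) (S : Set V) (u v : V) : Prop :=
  ∃ (hu : u ∈ Sᶜ) (hv : v ∈ Sᶜ), (G.induce Sᶜ).Reachable ⟨u, hu⟩ ⟨v, hv⟩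

namespace ReachableOff

variable {V : Type*} {G : SimpleGraph V} {S : Set V} {u v w : V}

theorem refl (hu : u ∉ S) : G.ReachableOff S u u := ⟨hu, hu, Reachable.refl _⟩

theorem symm (h : G.ReachableOff S u v) : G.ReachableOff S v u :=
  ⟨h.2.1, h.1, h.2.2.symm⟩

theorem trans (h : G.ReachableOff S u v) (h' : G.ReachableOff S v w) : G.ReachableOff S u w :=
  ⟨h.1, h'.2.1, h.2.2.trans h'.2.2⟩

theorem of_adj (hu : u ∉ S) (hv : v ∉ S) (h : G.Adj u v) : G.ReachableOff S u v :=
  ⟨hu, hv, Adj.reachable (by simpa using h)⟩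

end ReachableOff

theorem induce_compl_connected {V : Type*} {G : SimpleGraph V} {S : Set V} (x : V)
    (hx : x ∉ S) (h : ∀ v ∉ S, G.ReachableOff S v x) : (G.induce Sᶜ).Connected where
  preconnected u v := (h u u.2).2.2.trans (h v v.2).2.2.symm
  nonempty := ⟨⟨x, hx⟩⟩

theorem exists_notMem_of_card_lt {V : Type*} (S : Finset V) {m : ℕ} (f : Fin m → V)
    (hf : Function.Injective f) (hS : S.card < m) : ∃ b, f b ∉ S := by
  by_contra! h
  have := Finset.card_le_card_of_injOn f (s := Finset.univ) (t := S) (fun b _ => h b) hf.injOn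
  simp at this
  omega

theorem XGraph_block_reachable {n : ℕ} {S : Finset (XVertex (n + 1))} (hS : S.card < 3)
    {i : Fin (n + 1)} {a b : Fin 3 ⊕ Fin 3} (ha : some (i, a) ∉ S) (hb : some (i, b) ∉ S) :
    (XGraph (n + 1)).ReachableOff S (some (i, a)) (some (i, b)) := by
  have adj : ∀ x y : Fin 3,
      (XGraph (n + 1)).Adj (some (i, Sum.inl x)) (some (i, Sum.inr y)) := by
    intro x y
    simp [XGraph_adj_some_some]
  obtain ⟨x, hx⟩ := exists_notMem_of_card_lt S
    (fun x : Fin 3 => (some (i, Sum.inl x) : XVertex (n + 1))) (fun x y h => by simpa using h) hS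
  obtain ⟨y, hy⟩ := exists_notMem_of_card_lt S
    (fun x : Fin 3 => (some (i, Sum.inr x) : XVertex (n + 1))) (fun x y h => by simpa using h) hS
  have key : ∀ c, some (i, c) ∉ S →
      (XGraph (n + 1)).ReachableOff S (some (i, c)) (some (i, Sum.inr y)) := by
    rintro (c | c) hc
    · exact .of_adj hc hy (adj c y)
    · exact (ReachableOff.of_adj hx hc (adj x c)).symm.trans (.of_adj hx hy (adj x y))
  exact (key a ha).trans (key b hb).symm

theorem XGraph_link_reachable {n : ℕ} {S : Finset (XVertex (n + 1))} (hS : S.card < 3)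
    {i : Fin (n + 1)} {a b : Fin 3 ⊕ Fin 3} (ha : some (i, a) ∉ S) (hb : some (i + 1, b) ∉ S)
    (h2 : some (i, Sum.inl 2) ∉ S) (h1 : some (i + 1, Sum.inl 1) ∉ S) :
    (XGraph (n + 1)).ReachableOff S (some (i, a)) (some (i + 1, b)) :=
  ((XGraph_block_reachable hS ha h2).trans
    (.of_adj h2 h1 (by simp [XGraph_adj_some_some]))).trans (XGraph_block_reachable hS h1 hb)

theorem fin_reachable_of_all_but_one {n : ℕ} (R : Fin (n + 1) → Fin (n + 1) → Prop)
    (hrefl : ∀ i, R i i) (htrans : ∀ i j k, R i j → R j k → R i k) (i₀ : Fin (n + 1))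
    (hR : ∀ i, i ≠ i₀ → R i (i + 1)) (i : Fin (n + 1)) : R (i₀ + 1) i := by
  have key : ∀ j : ℕ, j ≤ n → R (i₀ + 1) (i₀ + 1 + Fin.ofNat (n + 1) j) := by
    intro j
    induction j with
    | zero => intro _; simpa using hrefl _
    | succ j ih =>
      intro hj
      have hs : Fin.ofNat (n + 1) (j + 1) = Fin.ofNat (n + 1) j + 1 := by
        ext; simp [Fin.val_add]
      refine htrans _ _ _ (ih (by omega)) ?_
      rw [hs, ← add_assoc]
      refine hR _ fun h => ?_
      have h0 : Fin.ofNat (n + 1) (j + 1) = 0 := by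
        rw [hs]
        have := congrArg (· - i₀) h
        simp only [sub_self] at this
        rw [← this]
        abel
      have := congrArg Fin.val h0
      simp [Nat.mod_eq_of_lt (show j + 1 < n + 1 by omega)] at this
  have := key (i - (i₀ + 1)).val (by omega)
  simpa using this

theorem XGraph_induce_connected (n : ℕ) (hn : 2 ≤ n) (S : Finset (XVertex (n + 1)))
    (hS : S.card < 3) : ((XGraph (n + 1)).induce (S : Set (XVertex (n + 1)))ᶜ).Connected := by
  have hrep : ∀ i : Fin (n + 1), ∃ y : Fin 3, some (i, Sum.inr y) ∉ S := fun i =>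
    exists_notMem_of_card_lt S (fun x : Fin 3 => (some (i, Sum.inr x) : XVertex (n + 1)))
      (fun x y h => by simpa using h) hS
  choose y hy using hrep
  have h3 : ∀ a b c : XVertex (n + 1), a ∈ S → b ∈ S → c ∈ S → a ≠ b → a ≠ c → b ≠ c →
      False := by
    intro a b c ha hb hc hab hac hbc
    have : ({a, b, c} : Finset (XVertex (n + 1))) ⊆ S := by
      intro x; simp only [Finset.mem_insert, Finset.mem_singleton]; grind
    have := Finset.card_le_card this
    rw [Finset.card_eq_three.2 ⟨a, b, c, hab, hac, hbc, rfl⟩] at this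
    omega
  have h1 : (1 : Fin (n + 1)) ≠ 0 := by
    intro h; have := congrArg Fin.val h; simp at this; omega
  have h2 : (1 + 1 : Fin (n + 1)) ≠ 0 := by
    intro h; have := congrArg Fin.val h
    simp only [Fin.val_add, Fin.val_one', Fin.val_zero] at this
    rw [Nat.mod_eq_of_lt (show 1 < n + 1 by omega), Nat.mod_eq_of_lt (by omega)] at this
    omega
  by_cases hub : none ∈ S
  · let R : Fin (n + 1) → Fin (n + 1) → Prop := fun i j =>
      (XGraph (n + 1)).ReachableOff S (some (i, Sum.inr (y i))) (some (j, Sum.inr (y j)))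
    have hlink : ∃ i₀, ∀ i, i ≠ i₀ → R i (i + 1) := by
      by_cases hall : ∀ i, R i (i + 1)
      · exact ⟨0, fun i _ => hall i⟩
      · push Not at hall
        obtain ⟨i₀, hi₀⟩ := hall
        refine ⟨i₀, fun i hi => ?_⟩
        by_contra hcon
        have broken : ∀ i, ¬ R i (i + 1) →
            some (i, Sum.inl 2) ∈ S ∨ some (i + 1, Sum.inl 1) ∈ S := by
          intro i h
          by_contra! h'
          exact h (XGraph_link_reachable hS (hy i) (hy (i + 1)) h'.1 h'.2)
        rcases broken i₀ hi₀ with h | h <;> rcases broken i hcon with h' | h' <;>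
          refine h3 none _ _ hub h h' (by simp) (by simp) ?_ <;> simp [Ne.symm hi]
    obtain ⟨i₀, hi₀⟩ := hlink
    have hconn := fin_reachable_of_all_but_one R (fun i => .refl (hy i))
      (fun i j k => .trans) i₀ hi₀
    refine induce_compl_connected (some (i₀ + 1, Sum.inr (y (i₀ + 1)))) (hy _) ?_
    rintro (_ | ⟨i, a⟩) hv
    · exact absurd hub hv
    · exact (XGraph_block_reachable hS hv (hy i)).trans (hconn i).symm
  · have direct : ∀ i a, some (i, Sum.inl 0) ∉ S → some (i, a) ∉ S →
        (XGraph (n + 1)).ReachableOff S (some (i, a)) none := by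
      intro i a h0 ha
      exact (XGraph_block_reachable hS ha h0).trans
        (.of_adj h0 hub ((XGraph_adj_none_some _ _ _).2 rfl).symm)
    refine induce_compl_connected none hub ?_
    rintro (_ | ⟨i, a⟩) hv
    · exact .refl hub
    by_cases h0 : some (i, Sum.inl 0) ∈ S
    · by_cases hnext : some (i + 1, Sum.inl 0) ∉ S ∧ some (i, Sum.inl 2) ∉ S ∧
          some (i + 1, Sum.inl 1) ∉ S
      · exact (XGraph_link_reachable hS hv (hy _) hnext.2.1 hnext.2.2).trans
          (direct _ _ hnext.1 (hy _))
      obtain ⟨j, rfl⟩ : ∃ j, i = j + 1 := ⟨i - 1, (sub_add_cancel i 1).symm⟩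
      have hj : j + 1 + 1 ≠ j := by simpa [add_assoc] using h2
      have hj' : j + 1 ≠ j := by simpa using h1
      have hj'' : j + 1 + 1 ≠ j + 1 := by simpa using h1
      have other : ∃ x ∈ S, x ≠ some (j + 1, Sum.inl 0) ∧ x ≠ some (j, Sum.inl 0) ∧
          x ≠ some (j, Sum.inl 2) ∧ x ≠ some (j + 1, Sum.inl 1) := by
        by_contra! hc
        apply hnext
        refine ⟨fun h => ?_, fun h => ?_, fun h => ?_⟩
        · simpa [hj, hj', hj''] using hc _ h
        · simpa [hj, hj', hj''] using hc _ h
        · simpa [hj, hj', hj''] using hc _ h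
      obtain ⟨x, hx, hx0, hx1, hx2, hx3⟩ := other
      have out : ∀ z, z ≠ some (j + 1, Sum.inl 0) → x ≠ z → z ∉ S :=
        fun z hz hxz hzS => h3 _ _ _ h0 hx hzS hx0.symm hz.symm hxz
      exact (XGraph_link_reachable hS (hy j) hv (out _ (by simp) hx2)
        (out _ (by simp) hx3)).symm.trans (direct _ _ (out _ (by simp [Ne.symm hj']) hx1) (hy j))
    · exact direct i a h0 hv

theorem XGraph_isVertexConnected_three (n : ℕ) (hn : 2 ≤ n) :
    (XGraph (n + 1)).IsVertexConnected 3 := by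
  refine ⟨?_, XGraph_induce_connected n hn⟩
  rw [ENat.card_eq_coe_fintype_card]
  simp only [Fintype.card_option, Fintype.card_prod, Fintype.card_fin, Fintype.card_sum]
  exact_mod_cast (by omega : 3 < (n + 1) * (3 + 3) + 1)

theorem XGraph_not_isCompleteCutset (n : ℕ) (hn : 2 ≤ n) (S : Set (XVertex (n + 1))) :
    ¬ (XGraph (n + 1)).IsCompleteCutset S := by
  classical
  rintro ⟨hclique, hcut⟩
  have hcard : S.toFinset.card < 3 := by
    by_contra! h
    obtain ⟨u, v, w, hu, hv, hw, huv, huw, hvw⟩ := Finset.two_lt_card_iff.1 h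
    simp only [Set.mem_toFinset] at hu hv hw
    exact XGraph_cliqueFree_three n hn u v w (hclique hu hv huv) (hclique hu hw huw)
      (hclique hv hw hvw)
  have := (XGraph_induce_connected n hn S.toFinset hcard).preconnected
  rw [Set.coe_toFinset] at this
  exact hcut this

end SimpleGraph

theorem Matrix.pow_succ_apply_eq_sum_prod {α R : Type*} [Fintype α] [DecidableEq α]
    [CommSemiring R] (T : Matrix α α R) (k : ℕ) (x y : α) :
    (T ^ (k + 1)) x y = ∑ f : Fin k → α, ∏ i : Fin (k + 1),
      T (Fin.cons (α := fun _ => α) x f i) (Fin.snoc (α := fun _ => α) f y i) := by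
  induction k generalizing x with
  | zero => simp [Fin.snoc]
  | succ k ih =>
    rw [pow_succ', Matrix.mul_apply, ← (Fin.consEquiv fun _ : Fin (k + 1) => α).sum_comp,
      Fintype.sum_prod_type]
    refine Finset.sum_congr rfl fun z _ => ?_
    rw [ih, Finset.mul_sum]
    refine Finset.sum_congr rfl fun f _ => ?_
    change _ = ∏ i, T (Fin.cons (α := fun _ => α) x (Fin.cons (α := fun _ => α) z f) i)
      (Fin.snoc (α := fun _ => α) (Fin.cons (α := fun _ => α) z f) y i)
    rw [Fin.prod_univ_succ (n := k + 1), ← Fin.cons_snoc_eq_snoc_cons]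
    simp only [Fin.cons_zero, Fin.cons_succ]

theorem Matrix.trace_pow_succ_eq_sum_prod {α R : Type*} [Fintype α] [DecidableEq α]
    [CommSemiring R] (T : Matrix α α R) (k : ℕ) :
    (T ^ (k + 1)).trace = ∑ f : Fin (k + 1) → α, ∏ i, T (f i) (f (i + 1)) := by
  rw [← (Fin.consEquiv fun _ : Fin (k + 1) => α).sum_comp, Fintype.sum_prod_type]
  refine Finset.sum_congr rfl fun x _ => ?_
  rw [Matrix.diag_apply, Matrix.pow_succ_apply_eq_sum_prod]
  refine Finset.sum_congr rfl fun f _ => Finset.prod_congr rfl fun i _ => ?_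
  congr 1
  refine Fin.lastCases ?_ (fun i => ?_) i
  · simp [Fin.consEquiv]
  · simp [Fin.consEquiv, Fin.coeSucc_eq_succ]

theorem natCard_blockColoring {α : Type*} [Fintype α] [DecidableEq α] (h x y : α) :
    (Nat.card {s : Fin 3 ⊕ Fin 3 → α // (∀ a b, s (.inl a) ≠ s (.inr b)) ∧ s (.inl 0) ≠ h ∧
      s (.inl 1) = x ∧ s (.inl 2) ≠ y} : ℤ) = transfer h x y := by
  let e : {s : Fin 3 ⊕ Fin 3 → α // (∀ a b, s (.inl a) ≠ s (.inr b)) ∧ s (.inl 0) ≠ h ∧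
      s (.inl 1) = x ∧ s (.inl 2) ≠ y} ≃
      (Σ r : {r : α // r ≠ y}, Σ m : {m : α // m ≠ h},
        (Fin 3 → {z : α // z ∉ ({m.1, x, r.1} : Finset α)})) :=
    { toFun s := ⟨⟨s.1 (.inl 2), s.2.2.2.2⟩, ⟨s.1 (.inl 0), s.2.2.1⟩, fun b => ⟨s.1 (.inr b), by
        have h0 := s.2.1 0 b
        have h1 := s.2.1 1 b
        have h2 := s.2.1 2 b
        rw [s.2.2.2.1] at h1
        simp [Ne.symm h0, Ne.symm h1, Ne.symm h2]⟩⟩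
      invFun p := ⟨Sum.elim ![p.2.1.1, x, p.1.1] (fun b => (p.2.2 b).1), by
        refine ⟨fun a b => ?_, p.2.1.2, rfl, p.1.2⟩
        have := (p.2.2 b).2
        simp only [Finset.mem_insert, Finset.mem_singleton, not_or] at this
        fin_cases a
        · exact Ne.symm this.1
        · exact Ne.symm this.2.1
        · exact Ne.symm this.2.2⟩
      left_inv s := by
        ext (a | b)
        · fin_cases a
          · rfl
          · exact s.2.2.2.1.symm
          · rfl
        · rfl
      right_inv p := rfl }
  rw [Nat.card_congr e, Nat.card_sigma, Nat.cast_sum]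
  simp only [Nat.card_sigma, Nat.card_fun, Nat.card_fin, Nat.cast_sum, Nat.cast_pow]
  have hcard : ∀ s : Finset α, (Nat.card {z // z ∉ s} : ℤ) = Fintype.card α - s.card := by
    intro s
    rw [Nat.card_eq_fintype_card, Fintype.card_subtype_compl, Nat.cast_sub]
    · simp
    · simpa using Finset.card_le_univ s
  simp only [hcard, transfer, Matrix.of_apply]
  have hsub : ∀ (z : α) (g : α → ℤ),
      ∑ r : {r // r ≠ z}, g r = ∑ r, if r = z then 0 else g r := by
    intro z g
    rw [← Finset.sum_subtype (Finset.univ.filter (· ≠ z)) (by simp) g, Finset.sum_filter]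
    simp only [ne_eq, ite_not]
  rw [← hsub y]
  exact Finset.sum_congr rfl fun r _ =>
    hsub h fun m => ((Fintype.card α : ℤ) - ({m, x, r.1} : Finset α).card) ^ 3

namespace SimpleGraph

theorem natCard_coloring_XGraph {α : Type*} [Fintype α] [DecidableEq α] (n : ℕ) :
    (Nat.card ((XGraph (n + 1)).Coloring α) : ℤ) = ∑ h : α, (transfer h ^ (n + 1)).trace := by
  let e : (XGraph (n + 1)).Coloring α ≃ (Σ h : α, Σ f : Fin (n + 1) → α, ∀ i,
      {s : Fin 3 ⊕ Fin 3 → α // (∀ a b, s (.inl a) ≠ s (.inr b)) ∧ s (.inl 0) ≠ h ∧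
        s (.inl 1) = f i ∧ s (.inl 2) ≠ f (i + 1)}) :=
    { toFun C := ⟨C none, fun i => C (some (i, .inl 1)), fun i => ⟨fun a => C (some (i, a)),
        fun a b => C.valid (by simp [XGraph_adj_some_some]),
        (C.valid (by simp [XGraph_adj_none_some])).symm, rfl,
        C.valid (by simp [XGraph_adj_some_some])⟩⟩
      invFun p := Coloring.mk (fun v => v.elim p.1 fun w => (p.2.2 w.1).1 w.2) (by
        have key : ∀ u v, XRel (n + 1) u v →
            (u.elim p.1 fun w => (p.2.2 w.1).1 w.2) ≠ (v.elim p.1 fun w => (p.2.2 w.1).1 w.2) := by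
          rintro (_ | ⟨i, a⟩) (_ | ⟨j, b⟩) h
          · exact h.elim
          · obtain rfl : b = .inl 0 := h
            exact (p.2.2 j).2.2.1.symm
          · exact h.elim
          · rw [XRel_succ_some_some] at h
            rcases h with ⟨rfl, h⟩ | ⟨rfl, rfl, rfl⟩
            · rcases a with a | a <;> rcases b with b | b <;> simp at h
              · exact (p.2.2 i).2.1 a b
              · exact ((p.2.2 i).2.1 b a).symm
            · exact fun h => (p.2.2 i).2.2.2.2 (h.trans (p.2.2 (i + 1)).2.2.2.1)
        intro u v h
        rw [XGraph, fromRel_adj] at h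
        exact h.2.elim (key u v) fun h => (key v u h).symm)
      left_inv C := by
        ext (_ | v) <;> rfl
      right_inv := by
        rintro ⟨h, f, s⟩
        have hf : (fun i => (s i).1 (.inl 1)) = f := funext fun i => (s i).2.2.2.1
        refine Sigma.ext rfl (heq_of_eq (Sigma.ext hf (Function.hfunext rfl fun i j hij => ?_)))
        obtain rfl := eq_of_heq hij
        refine (Subtype.heq_iff_coe_eq fun x => ?_).2 rfl
        simp only [← hf]
        rfl }
  rw [Nat.card_congr e]
  simp only [Nat.card_sigma, Nat.card_pi, Nat.cast_sum, Nat.cast_prod, natCard_blockColoring,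
    Matrix.trace_pow_succ_eq_sum_prod]

open Polynomial in
theorem exists_transfer_pow_params (k : ℕ) : ∃ a b c d l : ℤ[X], VanishesToOrder k a b c d l ∧
    ∀ (q : ℕ) (h : Fin q), transfer h ^ k =
      hubMatrix h (a.eval (q : ℤ)) (b.eval (q : ℤ)) (c.eval (q : ℤ)) (d.eval (q : ℤ))
        (l.eval (q : ℤ)) := by
  induction k with
  | zero => exact ⟨1, 0, 0, 0, 1, by simp [VanishesToOrder], fun q h => by
    simpa using one_eq_hubMatrix h⟩
  | succ k ih =>
    obtain ⟨a, b, c, d, l, hv, hT⟩ := ih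
    obtain ⟨a', b', c', d', l', hv', hT'⟩ := exists_transfer_params
    refine ⟨_, _, _, _, _, hv.mul hv', fun q h => ?_⟩
    rw [pow_succ, hT, hT', hubMatrix_mul h _ _ _ _ _ _ _ _ _ _ ((q : ℤ) - 1) (by simp)]
    simp

open Polynomial in
theorem X_sub_two_pow_dvd_chromaticPolynomial_XGraph (n : ℕ) :
    (X - C (2 : ℤ)) ^ (n + 1) ∣ (XGraph (n + 1)).chromaticPolynomial := by
  obtain ⟨a, b, c, d, l, ⟨ha, -, -, hd, hl⟩, hT⟩ := exists_transfer_pow_params (n + 1)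
  have hP : (XGraph (n + 1)).chromaticPolynomial = X * (a + (X - 1) * (d + l)) := by
    refine eq_of_infinite_eval_eq _ _ ((Set.infinite_range_of_injective
      (Nat.cast_injective (R := ℤ))).mono ?_)
    rintro _ ⟨q, rfl⟩
    rw [Set.mem_ofPred_eq, eval_chromaticPolynomial, natCard_coloring_XGraph]
    simp only [hT, trace_hubMatrix _ _ _ _ _ _ ((q : ℤ) - 1)
      (show (Fintype.card (Fin q) : ℤ) = _ by simp)]
    simp
  rw [hP]
  refine Dvd.dvd.mul_left ?_ X
  convert (ha.add hd).add (hl.mul_left (X - C 2)) using 1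
  simp; ring

theorem chromaticPolynomial_ne_zero {V : Type*} [Finite V] (G : SimpleGraph V) :
    G.chromaticPolynomial ≠ 0 := by
  intro h
  have := G.eval_chromaticPolynomial (Nat.card V)
  rw [h, Polynomial.eval_zero, eq_comm, Nat.cast_eq_zero, Nat.card_eq_zero] at this
  rcases this with h | h
  · exact h.elim' (Coloring.mk (Finite.equivFin V) fun {v w} hvw => by simpa using hvw.ne)
  · have : Finite (G.Coloring (Fin (Nat.card V))) := DFunLike.finite _
    exact not_finite (G.Coloring (Fin (Nat.card V)))

end SimpleGraph

theorem mainTheorem3 :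
    (∀ k : ℕ, 1 ≤ k →
      (Polynomial.X - Polynomial.C (2 : ℤ)) ^ k ∣ (SimpleGraph.XGraph k).chromaticPolynomial) ∧
    (∀ k : ℕ, 3 ≤ k →
      (SimpleGraph.XGraph k).IsVertexConnected 3 ∧
      ¬ ∃ S : Set (SimpleGraph.XVertex k), (SimpleGraph.XGraph k).IsCompleteCutset S) ∧
    (∀ k : ℕ, ∃ (V : Type) (_ : Finite V) (G : SimpleGraph V),
      G.IsVertexConnected 3 ∧
      (¬ ∃ S : Set V, G.IsCompleteCutset S) ∧
      (Polynomial.X - Polynomial.C (2 : ℤ)) ^ k ∣ G.chromaticPolynomial ∧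
      k ≤ G.chromaticPolynomial.rootMultiplicity 2) := by
  refine ⟨fun k hk => ?_, fun k hk => ?_, fun k => ?_⟩
  · obtain ⟨n, rfl⟩ := Nat.exists_eq_add_of_le' hk
    exact SimpleGraph.X_sub_two_pow_dvd_chromaticPolynomial_XGraph n
  · obtain ⟨n, rfl⟩ := Nat.exists_eq_add_of_le' hk
    exact ⟨SimpleGraph.XGraph_isVertexConnected_three (n + 2) (by omega),
      fun ⟨S, hS⟩ => SimpleGraph.XGraph_not_isCompleteCutset (n + 2) (by omega) S hS⟩
  · have hdvd : (Polynomial.X - Polynomial.C (2 : ℤ)) ^ k ∣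
        (SimpleGraph.XGraph (k + 2 + 1)).chromaticPolynomial :=
      (pow_dvd_pow _ (by omega)).trans
        (SimpleGraph.X_sub_two_pow_dvd_chromaticPolynomial_XGraph (k + 2))
    exact ⟨SimpleGraph.XVertex (k + 2 + 1), inferInstance, SimpleGraph.XGraph (k + 2 + 1),
      SimpleGraph.XGraph_isVertexConnected_three (k + 2) (by omega),
      fun ⟨S, hS⟩ => SimpleGraph.XGraph_not_isCompleteCutset (k + 2) (by omega) S hS, hdvd,
      (Polynomial.le_rootMultiplicity_iff
        (SimpleGraph.chromaticPolynomial_ne_zero _)).2 hdvd⟩
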